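/- Theorem 1. Let $n\ge 2$ and consider the ring with nodes $1,\dots,n$ and edges $e_i=\{i,i+1\}$ for $1\le i\le n$ (where $n+1$ means $1$), together with demands $d_{i,j}\ge 0$ for $1\le i<j\le n$; put $D=\max_{i<j}d_{i,j}$. A split routing sends, for each pair $i<j$, an amount $x_{i,j}\in[0,d_{i,j}]$ along the clockwise path $i,i+1,\dots,j$ and the remaining amount $d_{i,j}-x_{i,j}$ along the complementary (counter-clockwise) path; it is unsplittable if $x_{i,j}\in\{0,d_{i,j}\}$ for all $i<j$. The load of an edge is the total amount routed along paths that use it, and the load of a routing is the maximum load of an edge. Let $L$ be the minimum load of an unsplittable routing and $L^*$ the minimum load of a split routing. (a) For every split routing there is an unsplittable routing in which the load of every edge is at most its load in the split routing plus $\frac{13}{10}D$. In particular, $L\le L^*+\frac{13}{10}D$. (b) Let $\beta$ be the infimum of all real numbers $\alpha$ with the following property: for all positive integers $m$ and all nonnegative reals $u_1,\dots,u_m$ and $v_1,\dots,v_m$ with $u_i+v_i\le 1$ for every $i$, there exist $z_1,\dots,z_m$ with $z_k\in\{v_k,-u_k\}$ and $$\Bigl|\sum_{i=1}^{k}z_i-\sum_{i=k+1}^{m}z_i\Bigr|\le\alpha$$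 for every $k\in\{1,\dots,m\}$. Then $\beta\in\left[\frac{11}{10},\frac{13}{10}\right]$. -/

import Mathlib

/-- The demands of the ring loading problem on the ring with nodes `0, …, n - 1`: one for each pair
of nodes `i < j`. -/
abbrev RingPair (n : ℕ) : Type := {p : Fin n × Fin n // p.1 < p.2}

namespace RingLoading

/-- The edges of the ring are indexed by `Fin n`, the edge `e` joining the nodes `e` and `e + 1`
(mod `n`). The clockwise path of the pair `i < j` is `i, i + 1, …, j`, with edges
`i, i + 1, …, j - 1`. -/
def clockwisePath {n : ℕ} (p : RingPair n) : Finset (Fin n) :=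
  Finset.Ico p.1.1 p.1.2

/-- The counter-clockwise path `i, i - 1, …, 0, n - 1, …, j` of the pair `i < j` consists of all the
other edges of the ring. -/
def counterclockwisePath {n : ℕ} (p : RingPair n) : Finset (Fin n) :=
  (clockwisePath p)ᶜ

/-- A split routing of the demands `d`, given by the amount `x p` of each demand `p` that is routed
clockwise; the remaining amount `d p - x p` is routed counter-clockwise. -/
def IsSplitRouting {n : ℕ} (d x : RingPair n → ℝ) : Prop :=
  ∀ p, 0 ≤ x p ∧ x p ≤ d p

/-- An unsplittable routing sends each demand completely clockwise or completely
counter-clockwise. -/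
def IsUnsplittableRouting {n : ℕ} (d x : RingPair n → ℝ) : Prop :=
  ∀ p, x p = d p ∨ x p = 0

/-- The load of the edge `e` under the routing `x` of the demands `d`. -/
noncomputable def edgeLoad {n : ℕ} (d x : RingPair n → ℝ) (e : Fin n) : ℝ :=
  (∑ p with e ∈ clockwisePath p, x p) + ∑ p with e ∈ counterclockwisePath p, (d p - x p)

/-- The load of a routing: the maximum load of an edge. -/
noncomputable def load {n : ℕ} (d x : RingPair n → ℝ) : ℝ :=
  ⨆ e, edgeLoad d x e

/-- `D`, the maximum demand value. -/
noncomputable def maxDemand {n : ℕ} (d : RingPair n → ℝ) : ℝ :=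
  ⨆ p, d p

/-- `L`, the minimum load of an unsplittable routing. -/
noncomputable def unsplittableOpt {n : ℕ} (d : RingPair n → ℝ) : ℝ :=
  sInf {l | ∃ x, IsUnsplittableRouting d x ∧ load d x = l}

/-- `L*`, the minimum load of a split routing. -/
noncomputable def splitOpt {n : ℕ} (d : RingPair n → ℝ) : ℝ :=
  sInf {l | ∃ x, IsSplitRouting d x ∧ load d x = l}

/-- The minimum in the definition of `L` is attained. -/
theorem isLeast_unsplittableOpt {n : ℕ} (d : RingPair n → ℝ) :
    IsLeast {l | ∃ x, IsUnsplittableRouting d x ∧ load d x = l} (unsplittableOpt d) := by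
  have hfin : {x : RingPair n → ℝ | IsUnsplittableRouting d x}.Finite := by
    refine (Set.Finite.pi' (t := fun p => {d p, 0}) fun p => Set.toFinite _).subset ?_
    intro x hx p
    simpa using hx p
  have h := hfin.image (load d)
  have hne : (load d '' {x : RingPair n → ℝ | IsUnsplittableRouting d x}).Nonempty :=
    ⟨_, d, fun _ => Or.inl rfl, rfl⟩
  exact ⟨hne.csInf_mem h, fun _ hl => csInf_le h.bddBelow hl⟩

/-- The minimum in the definition of `L*` is attained. -/
theorem isLeast_splitOpt {n : ℕ} (hn : 2 ≤ n) (d : RingPair n → ℝ) (hd : ∀ p, 0 ≤ d p) :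
    IsLeast {l | ∃ x, IsSplitRouting d x ∧ load d x = l} (splitOpt d) := by
  have : Nonempty (Fin n) := ⟨⟨0, by omega⟩⟩
  have hset : {x : RingPair n → ℝ | IsSplitRouting d x} = Set.Icc 0 d := by
    ext x
    simp [IsSplitRouting, Set.mem_Icc, Pi.le_def, forall_and]
  have hK : IsCompact {x : RingPair n → ℝ | IsSplitRouting d x} := hset ▸ isCompact_Icc
  have hc : Continuous fun x : RingPair n → ℝ => load d x := by
    have heq : (fun x : RingPair n → ℝ => load d x)
        = fun x => Finset.univ.sup' Finset.univ_nonempty fun e => edgeLoad d x e := by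
      funext x
      rw [Finset.sup'_univ_eq_ciSup]
      rfl
    rw [heq]
    refine Continuous.finset_sup'_apply _ fun e _ => ?_
    unfold edgeLoad
    fun_prop
  have h := hK.image hc
  have hne : (load d '' {x : RingPair n → ℝ | IsSplitRouting d x}).Nonempty :=
    ⟨_, d, fun p => ⟨hd p, le_rfl⟩, rfl⟩
  exact ⟨h.sInf_mem hne, fun _ hl => csInf_le h.bddBelow hl⟩

/-- The combinatorial statement with parameter `α` of Schrijver, Seymour and Winkler (the indices
`1, …, m` are represented by `Fin m`). -/
def AlternatingBound (α : ℝ) : Prop :=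
  ∀ m : ℕ, 1 ≤ m → ∀ u v : Fin m → ℝ,
    (∀ i, 0 ≤ u i) → (∀ i, 0 ≤ v i) → (∀ i, u i + v i ≤ 1) →
    ∃ z : Fin m → ℝ, (∀ k, z k = v k ∨ z k = -u k) ∧
      ∀ k, |(∑ i with i ≤ k, z i) - (∑ i with k < i, z i)| ≤ α

/-- The constant `β` of Schrijver, Seymour and Winkler. -/
noncomputable def sswBeta : ℝ :=
  sInf {α : ℝ | AlternatingBound α}

end RingLoading

/-! Part (a) reduces to `AlternatingBound`. Two split demands that do not cross can be rerouted
against each other, raising no load, until one is unsplit; so all split demands may be taken to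
cross pairwise. Listed by first node, they contribute to each edge with signs that change at most
once along the list, and rounding them is an instance of `AlternatingBound`.

For `AlternatingBound (1 + h)` with 1/4 ≤ h < 1/2, suppose every choice fails. The partial sums S_k
of a choice give a walk p_k = x + S_k, and 2 S_k - S_m = (2 p_k - 1) - (p_m - (1 - x)). Hence no
walk from x inside [0,1] ends within h of 1 - x. Splicing it with a walk into 1 - x (whose positions
serve as labels) shows that every next position, allowed or not, is more than h away from every
label. Let the moves comply with labels, and count the downward moves along items with u + v > 2h.
The counter, minus 1 if the position is below the label, is an invariant: at time m it depends only
on x (`NoGoodChoice.invariant_eq`), and by connectedness of [0,1] not even on x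
(`NoGoodChoice.invariant_zero_eq_one`). After scaling and rotation the first item has u + v = 1, so
the walks from 0 and from 1 meet at time 1 with counters 0 and 1. Continuing both from the meeting
point contradicts the equality of the two invariants (`not_noGoodChoice`). The constant 13/10 is h =
3/10.

The lower bound 11/10 comes from nine explicit items. -/

namespace RingLoading

/-! ### Local analysis of one move -/

/-- Two states `(position, counter)` agree relative to the label `o`: the counters corrected by the
side of `o` coincide, and states on the same side of `o` are close to each other. -/
def Agree (h o : ℝ) (s s' : ℝ × ℤ) : Prop :=
  (s.2 - if s.1 < o then 1 else 0) = (s'.2 - if s'.1 < o then 1 else 0) ∧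
    ((s.1 < o ↔ s'.1 < o) → |s.1 - s'.1| ≤ 2 * h)

/-- A move of a state along an item `(u, v)` inside the unit interval which complies with the label
`o`: upwards by `v` only if the downward move does not end above `o`, and downwards by `u` only if
the upward move does not end below `o`. The counter records the downward moves along items with
`2 * h < u + v`. -/
def Move (h u v o : ℝ) (s s' : ℝ × ℤ) : Prop :=
  (s'.1 = s.1 + v ∧ s'.1 ≤ 1 ∧ s.1 - u ≤ o ∧ s'.2 = s.2) ∨
    (s'.1 = s.1 - u ∧ 0 ≤ s'.1 ∧ o ≤ s.1 + v ∧ s'.2 = s.2 + if 2 * h < u + v then 1 else 0)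

theorem Agree.refl {h : ℝ} (hh : 1 / 4 ≤ h) (o : ℝ) (s : ℝ × ℤ) : Agree h o s s :=
  ⟨rfl, fun _ => by simp; linarith⟩

/-- States on one side of `o` that move differently and stay on one side of `o'` would be more than
2h apart. States on opposite sides of `o` are more than 2h apart, since one candidate position of
each is the shift that takes `o` to `o'`. If they end on the same side, the item is big and they end
within 1 - 2h; if they stay on opposite sides and one of them moves against the label, u + v < 1 -
2h. Both use 1 - 2h ≤ 2h. -/
theorem Agree.move {h u v o o' : ℝ} {s s' t t' : ℝ × ℤ} (hh : 1 / 4 ≤ h) (hu : 0 ≤ u) (hv : 0 ≤ v)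
    (huv : u + v ≤ 1) (hs : s.1 ∈ Set.Icc (0 : ℝ) 1) (hs' : s'.1 ∈ Set.Icc (0 : ℝ) 1)
    (ho : o' = o + v ∨ o' = o - u)
    (h1 : h < |s.1 + v - o'|) (h2 : h < |s.1 - u - o'|)
    (h3 : h < |s'.1 + v - o'|) (h4 : h < |s'.1 - u - o'|)
    (hA : Agree h o s s') (hst : Move h u v o' s t) (hst' : Move h u v o' s' t') :
    Agree h o' t t' := by
  obtain ⟨a, N⟩ := s
  obtain ⟨b, K⟩ := s'
  obtain ⟨a', N'⟩ := t
  obtain ⟨b', K'⟩ := t'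
  simp only [Agree, Move, Set.mem_Icc] at *
  obtain ⟨hI, hc⟩ := hA
  obtain ⟨ha0, ha1⟩ := hs
  obtain ⟨hb0, hb1⟩ := hs'
  rw [lt_abs] at h1 h2 h3 h4
  rw [abs_le] at hc ⊢
  have ite1 : ∀ x y : ℝ, (x < y ∧ (if x < y then (1 : ℤ) else 0) = 1) ∨
      (y ≤ x ∧ (if x < y then (1 : ℤ) else 0) = 0) := fun x y => by
    rcases lt_or_ge x y with hxy | hxy
    · exact .inl ⟨hxy, if_pos hxy⟩
    · exact .inr ⟨hxy, if_neg hxy.not_gt⟩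
  have hc' : (a < o → b < o → (-(2 * h) ≤ a - b ∧ a - b ≤ 2 * h)) ∧
      (o ≤ a → o ≤ b → (-(2 * h) ≤ a - b ∧ a - b ≤ 2 * h)) :=
    ⟨fun h1 h2 => hc (by simp [h1, h2]), fun h1 h2 => hc (by simp [h1.not_gt, h2.not_gt])⟩
  obtain ⟨hc1, hc2⟩ := hc'
  clear hc
  rcases ite1 a o with ⟨a1, e1⟩ | ⟨a1, e1⟩ <;> rcases ite1 b o with ⟨b1, e2⟩ | ⟨b1, e2⟩ <;>
  rw [e1, e2] at hI <;>
  (first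
    | replace hc1 := hc1 a1 b1
    | replace hc1 := hc2 a1 b1
    | skip) <;> clear hc2 e1 e2 <;>
  rcases ho with rfl | rfl <;>
  rcases hst with ⟨rfl, p1, p2, rfl⟩ | ⟨rfl, p1, p2, rfl⟩ <;>
  rcases hst' with ⟨rfl, q1, q2, rfl⟩ | ⟨rfl, q1, q2, rfl⟩ <;>
  rcases h1 with h1 | h1 <;> (try (exfalso; linarith)) <;>
  rcases h2 with h2 | h2 <;> (try (exfalso; linarith)) <;>
  rcases h3 with h3 | h3 <;> (try (exfalso; linarith)) <;>
  rcases h4 with h4 | h4 <;> (try (exfalso; linarith)) <;>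
  by_cases hbig : 2 * h < u + v <;> (try (exfalso; linarith))
  all_goals
    try simp only [hbig, if_true, if_false]
    constructor
    · split_ifs <;> first | omega | (exfalso; linarith)
    · intro hiff
      first
      | (constructor <;> linarith)
      | (exfalso; first
          | (have := hiff.1 (by linarith); linarith)
          | (have := hiff.2 (by linarith); linarith))

/-- If the two moves differ and the item is big, its two candidate positions straddle `p` or `q`;
otherwise `p` and `q` are more than 2h apart with a candidate gap below 1 - 2h. A small item cannot
straddle a label. -/
theorem Move.agree_or_agree {h u v p q : ℝ} {s t t' : ℝ × ℤ} (hh : 1 / 4 ≤ h) (hu : 0 ≤ u)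
    (hv : 0 ≤ v) (hp : p ∈ Set.Icc (0 : ℝ) 1) (hq : q ∈ Set.Icc (0 : ℝ) 1)
    (h1 : h < |s.1 + v - p|) (h2 : h < |s.1 - u - p|)
    (h3 : h < |s.1 + v - q|) (h4 : h < |s.1 - u - q|)
    (hst : Move h u v p s t) (hst' : Move h u v q s t') :
    Agree h p t t' ∨ Agree h q t t' := by
  obtain ⟨a, N⟩ := s
  obtain ⟨b, K⟩ := t
  obtain ⟨b', K'⟩ := t'
  obtain ⟨hp0, hp1⟩ := hp
  obtain ⟨hq0, hq1⟩ := hq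
  have close : ∀ r : ℝ, ∀ M : ℤ, u + v ≤ 2 * h → ((a + v < r ∧ a - u < r) ∨ (r ≤ a + v ∧ r ≤ a - u)) →
      Agree h r (a + v, M) (a - u, M) ∧ Agree h r (a - u, M) (a + v, M) := by
    intro r M hw hr
    have e : |a + v - (a - u)| ≤ 2 * h := abs_le.2 ⟨by linarith, by linarith⟩
    rcases hr with ⟨r1, r2⟩ | ⟨r1, r2⟩
    · exact ⟨⟨by simp [r1, r2], fun _ => e⟩, ⟨by simp [r1, r2], fun _ => abs_sub_comm (a + v) _ ▸ e⟩⟩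
    · exact ⟨⟨by simp [r1.not_gt, r2.not_gt], fun _ => e⟩,
        ⟨by simp [r1.not_gt, r2.not_gt], fun _ => abs_sub_comm (a + v) _ ▸ e⟩⟩
  -- The extra count of the downward move is cancelled by its ending below the label.
  have far : ∀ r : ℝ, ∀ M : ℤ, a - u < r → r ≤ a + v →
      Agree h r (a + v, M) (a - u, M + 1) ∧ Agree h r (a - u, M + 1) (a + v, M) := by
    intro r M r1 r2
    refine ⟨⟨by simp [r1, r2.not_gt], fun hr => ?_⟩, ⟨by simp [r1, r2.not_gt], fun hr => ?_⟩⟩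
    · exact absurd (hr.2 r1) r2.not_gt
    · exact absurd (hr.1 r1) r2.not_gt
  simp only [Move] at hst hst' h1 h2 h3 h4
  rw [lt_abs] at h1 h2 h3 h4
  rcases hst with ⟨rfl, p1, p2, rfl⟩ | ⟨rfl, p1, p2, rfl⟩ <;>
  rcases hst' with ⟨rfl, q1, q2, rfl⟩ | ⟨rfl, q1, q2, rfl⟩
  · exact .inl (Agree.refl hh _ _)
  · by_cases hbig : 2 * h < u + v
    · rw [if_pos hbig]
      rcases h1 with h1 | h1
      · exact .inl (far p _ (by rcases h2 with h2 | h2 <;> linarith) (by linarith)).1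
      · exact .inr (far q _ (by rcases h4 with h4 | h4 <;> linarith) (by linarith)).1
    · rw [if_neg hbig, add_zero]
      exact .inl (close p _ (by linarith) (.inl (by
        rcases h1 with h1 | h1 <;> rcases h2 with h2 | h2 <;> constructor <;> linarith))).1
  · by_cases hbig : 2 * h < u + v
    · rw [if_pos hbig]
      rcases h3 with h3 | h3
      · exact .inr (far q _ (by rcases h4 with h4 | h4 <;> linarith) (by linarith)).2
      · exact .inl (far p _ (by rcases h2 with h2 | h2 <;> linarith) (by linarith)).2
    · rw [if_neg hbig, add_zero]
      exact .inr (close q _ (by linarith) (.inl (by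
        rcases h3 with h3 | h3 <;> rcases h4 with h4 | h4 <;> constructor <;> linarith))).2
  · exact .inl (Agree.refl hh _ _)

/-- If the downward move would end below 0, or the upward one below `o`, then the upward move is
admissible. -/
theorem exists_move (h : ℝ) {u v o : ℝ} (hu : 0 ≤ u) (hv : 0 ≤ v) (huv : u + v ≤ 1)
    (ho : o ∈ Set.Icc (0 : ℝ) 1) (s : ℝ × ℤ) : ∃ t, Move h u v o s t := by
  by_cases h1 : s.1 - u ≤ o ∧ s.1 + v ≤ 1
  · exact ⟨(s.1 + v, s.2), .inl ⟨rfl, h1.2, h1.1, rfl⟩⟩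
  · refine ⟨(s.1 - u, _), .inr ⟨rfl, ?_, ?_, rfl⟩⟩ <;> obtain ⟨o0, o1⟩ := ho <;>
    by_contra hc <;> exact h1 ⟨by linarith, by linarith⟩

/-! ### Chains of linked states -/

/-- The positions `R k` and labels `B k` at the times `k ≤ n`, such that the possible positions
after a move stay away from the labels. -/
structure LabelSystem (h : ℝ) (u v : ℕ → ℝ) (n : ℕ) (R B : ℕ → Set ℝ) : Prop where
  R_subset : ∀ k ≤ n, R k ⊆ Set.Icc 0 1
  B_subset : ∀ k ≤ n, B k ⊆ Set.Icc 0 1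
  up_mem : ∀ k < n, ∀ a ∈ R k, a + v k ≤ 1 → a + v k ∈ R (k + 1)
  down_mem : ∀ k < n, ∀ a ∈ R k, 0 ≤ a - u k → a - u k ∈ R (k + 1)
  exists_label : ∀ k < n, ∀ o ∈ B k, o + v k ∈ B (k + 1) ∨ o - u k ∈ B (k + 1)
  up_sep : ∀ k < n, ∀ a ∈ R k, ∀ o ∈ B (k + 1), h < |a + v k - o|
  down_sep : ∀ k < n, ∀ a ∈ R k, ∀ o ∈ B (k + 1), h < |a - u k - o|

/-- The states at time `k` of the trajectories from `s₀`. -/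
def Reach (h : ℝ) (u v : ℕ → ℝ) (B : ℕ → Set ℝ) (s₀ : ℝ × ℤ) : ℕ → Set (ℝ × ℤ)
  | 0 => {s₀}
  | k + 1 => {t | ∃ s ∈ Reach h u v B s₀ k, ∃ o ∈ B (k + 1), Move h (u k) (v k) o s t}

/-- States at time `k` which agree relative to some label. -/
def Link (h : ℝ) (R B : ℕ → Set ℝ) (k : ℕ) (s t : ℝ × ℤ) : Prop :=
  s.1 ∈ R k ∧ t.1 ∈ R k ∧ ∃ o ∈ B k, Agree h o s t

namespace LabelSystem
variable {h : ℝ} {u v : ℕ → ℝ} {n : ℕ} {R B : ℕ → Set ℝ}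

theorem mem_of_move (S : LabelSystem h u v n R B) {k : ℕ} (hk : k < n) {o : ℝ} {s t : ℝ × ℤ}
    (hs : s.1 ∈ R k) (hst : Move h (u k) (v k) o s t) : t.1 ∈ R (k + 1) := by
  rcases hst with ⟨h1, h2, -⟩ | ⟨h1, h2, -⟩
  · exact h1 ▸ S.up_mem k hk _ hs (h1 ▸ h2)
  · exact h1 ▸ S.down_mem k hk _ hs (h1 ▸ h2)

theorem mem_of_mem_reach (S : LabelSystem h u v n R B) {s₀ : ℝ × ℤ} (h0 : s₀.1 ∈ R 0) {k : ℕ}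
    (hk : k ≤ n) {s : ℝ × ℤ} (hs : s ∈ Reach h u v B s₀ k) : s.1 ∈ R k := by
  induction k generalizing s with
  | zero => exact (show s = s₀ from hs) ▸ h0
  | succ k ih =>
    obtain ⟨r, hr, o, -, hm⟩ := hs
    exact S.mem_of_move hk (ih (by omega) hr) hm

/-- A chain at time `k` is carried to time `k + 1`: both ends of a link relative to `o` move in
compliance with a successor of `o` and stay linked by `Agree.move`. Consecutive links may use
different labels, so a state may get two successors; `Move.agree_or_agree` links these. -/
theorem reflTransGen_link (S : LabelSystem h u v n R B) (hh : 1 / 4 ≤ h) (hu : ∀ k, 0 ≤ u k)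
    (hv : ∀ k, 0 ≤ v k) (huv : ∀ k, u k + v k ≤ 1) {s₀ : ℝ × ℤ} (h0 : s₀.1 ∈ R 0) {k : ℕ}
    (hk : k ≤ n) {s t : ℝ × ℤ} (hs : s ∈ Reach h u v B s₀ k) (ht : t ∈ Reach h u v B s₀ k) :
    Relation.ReflTransGen (Link h R B k) s t := by
  induction k generalizing s t with
  | zero =>
    obtain rfl : s = s₀ := hs
    obtain rfl : t = s := ht
    exact .refl
  | succ k ih =>
    obtain ⟨r, hr, p, hp, hm⟩ := hs
    obtain ⟨r', hr', q, hq, hm'⟩ := ht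
    have self : ∀ {a b c : ℝ × ℤ} {p q : ℝ}, a.1 ∈ R k → p ∈ B (k + 1) → q ∈ B (k + 1) →
        Move h (u k) (v k) p a b → Move h (u k) (v k) q a c → Link h R B (k + 1) b c := by
      intro a b c p q ha hp hq h1 h2
      refine ⟨S.mem_of_move hk ha h1, S.mem_of_move hk ha h2, ?_⟩
      rcases h1.agree_or_agree hh (hu k) (hv k) (S.B_subset _ hk hp) (S.B_subset _ hk hq)
        (S.up_sep k hk _ ha _ hp) (S.down_sep k hk _ ha _ hp) (S.up_sep k hk _ ha _ hq)
        (S.down_sep k hk _ ha _ hq) h2 with h3 | h3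
      exacts [⟨_, hp, h3⟩, ⟨_, hq, h3⟩]
    have hchain := ih (by omega) hr hr'
    have hrR := S.mem_of_mem_reach h0 (by omega) hr
    clear hr hr'
    induction hchain generalizing t q with
    | refl => exact .single (self hrR hp hq hm hm')
    | tail _ hl ih' =>
      obtain ⟨hb, hc, o, ho, hag⟩ := hl
      obtain ⟨o', ho', hoo⟩ : ∃ o' ∈ B (k + 1), o' = o + v k ∨ o' = o - u k := by
        rcases S.exists_label k hk o ho with h1 | h1
        exacts [⟨_, h1, .inl rfl⟩, ⟨_, h1, .inr rfl⟩]
      obtain ⟨t1, ht1⟩ := exists_move h (hu k) (hv k) (huv k) (S.B_subset _ hk ho') _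
      obtain ⟨t2, ht2⟩ := exists_move h (hu k) (hv k) (huv k) (S.B_subset _ hk ho') _
      refine ((ih' o' ho' ht1).tail ⟨S.mem_of_move hk hb ht1, S.mem_of_move hk hc ht2, o', ho',
        hag.move hh (hu k) (hv k) (huv k) (S.R_subset _ (by omega) hb)
          (S.R_subset _ (by omega) hc) hoo (S.up_sep k hk _ hb _ ho') (S.down_sep k hk _ hb _ ho')
          (S.up_sep k hk _ hc _ ho') (S.down_sep k hk _ hc _ ho') ht1 ht2⟩).tail
        (self hc ho' hq ht2 hm')

end LabelSystem

/-! ### Forward walks, backward walks and their separation -/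

/-- The sequences of signed items: each item `(u i, v i)` is used upwards, by `v i`, or downwards,
by `u i`. -/
def IsChoice (u v z : ℕ → ℝ) : Prop := ∀ i, z i = v i ∨ z i = -u i

/-- The positions at time `t` of the walks from `x` inside the unit interval. -/
def Fwd (u v : ℕ → ℝ) (x : ℝ) (t : ℕ) : Set ℝ :=
  {c | ∃ z, IsChoice u v z ∧ (∀ k ≤ t, x + ∑ i ∈ Finset.range k, z i ∈ Set.Icc (0 : ℝ) 1) ∧
    x + ∑ i ∈ Finset.range t, z i = c}

/-- The positions at time `t` of the walks inside the unit interval which arrive at `1 - x` at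
time `m`. -/
def Bwd (u v : ℕ → ℝ) (m : ℕ) (x : ℝ) (t : ℕ) : Set ℝ :=
  {o | ∃ z, IsChoice u v z ∧
    (∀ k, t ≤ k → k ≤ m → 1 - x - ∑ i ∈ Finset.Ico k m, z i ∈ Set.Icc (0 : ℝ) 1) ∧
    1 - x - ∑ i ∈ Finset.Ico t m, z i = o}

/-- No choice of signs satisfies the alternating bound `1 + h`. -/
def NoGoodChoice (h : ℝ) (u v : ℕ → ℝ) (m : ℕ) : Prop :=
  ∀ z, IsChoice u v z →
    ∃ k ≤ m, 1 + h < |2 * ∑ i ∈ Finset.range k, z i - ∑ i ∈ Finset.range m, z i|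

variable {h : ℝ} {u v : ℕ → ℝ} {m : ℕ} {x : ℝ}

theorem Fwd.subset (t : ℕ) : Fwd u v x t ⊆ Set.Icc 0 1 := by
  rintro _ ⟨z, -, hz, rfl⟩
  exact hz t le_rfl

theorem Bwd.subset {t : ℕ} (ht : t ≤ m) : Bwd u v m x t ⊆ Set.Icc 0 1 := by
  rintro _ ⟨z, -, hz, rfl⟩
  exact hz t le_rfl ht

theorem Fwd.add_mem {t : ℕ} {c z₀ : ℝ} (hc : c ∈ Fwd u v x t) (hz₀ : z₀ = v t ∨ z₀ = -u t)
    (hc' : c + z₀ ∈ Set.Icc (0 : ℝ) 1) : c + z₀ ∈ Fwd u v x (t + 1) := by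
  obtain ⟨z, hz, hz', rfl⟩ := hc
  have hsum : ∀ k ≤ t, ∑ i ∈ Finset.range k, Function.update z t z₀ i = ∑ i ∈ Finset.range k, z i :=
    fun k hk => Finset.sum_congr rfl fun i hi =>
      Function.update_of_ne (by have := Finset.mem_range.1 hi; omega) _ _
  have hlast : x + ∑ i ∈ Finset.range (t + 1), Function.update z t z₀ i
      = x + ∑ i ∈ Finset.range t, z i + z₀ := by
    rw [Finset.sum_range_succ, hsum t le_rfl, Function.update_self, add_assoc]
  refine ⟨Function.update z t z₀, fun i => ?_, fun k hk => ?_, hlast⟩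
  · rcases eq_or_ne i t with rfl | hi
    · simpa using hz₀
    · simpa [hi] using hz i
  · rcases hk.lt_or_eq with hk | rfl
    · rw [hsum k (by omega)]
      exact hz' k (by omega)
    · rwa [hlast]

theorem Bwd.add_mem {t : ℕ} (ht : t < m) {o : ℝ} (ho : o ∈ Bwd u v m x t) :
    o + v t ∈ Bwd u v m x (t + 1) ∨ o - u t ∈ Bwd u v m x (t + 1) := by
  obtain ⟨z, hz, hz', rfl⟩ := ho
  have h1 : 1 - x - ∑ i ∈ Finset.Ico t m, z i + z t ∈ Bwd u v m x (t + 1) :=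
    ⟨z, hz, fun k hk hk' => hz' k (by omega) hk', by
      rw [Finset.sum_eq_sum_Ico_succ_bot ht]
      ring⟩
  rcases hz t with e | e <;> rw [e] at h1
  · exact .inl h1
  · exact .inr (by rwa [sub_eq_add_neg])

theorem NoGoodChoice.lt_abs_sub_end (H : NoGoodChoice h u v m) {c : ℝ} (hc : c ∈ Fwd u v x m) :
    h < |c - (1 - x)| := by
  obtain ⟨z, hz, hz', rfl⟩ := hc
  obtain ⟨k, hk, hlt⟩ := H z hz
  obtain ⟨h0, h1⟩ := hz' k hk
  have e := abs_add_le (2 * (x + ∑ i ∈ Finset.range k, z i) - 1)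
    (-(x + ∑ i ∈ Finset.range m, z i - (1 - x)))
  rw [abs_neg] at e
  have e' : |2 * (x + ∑ i ∈ Finset.range k, z i) - 1| ≤ 1 := abs_le.2 ⟨by linarith, by linarith⟩
  have e'' : 2 * ∑ i ∈ Finset.range k, z i - ∑ i ∈ Finset.range m, z i
    = 2 * (x + ∑ i ∈ Finset.range k, z i) - 1 + -(x + ∑ i ∈ Finset.range m, z i - (1 - x)) := by ring
  rw [e''] at hlt
  linarith

/-- The spliced choice `Z` has a jump of c + z₀ - o between its two halves. Each half lies in [0,1],
so a jump of at most h would make `Z` good. The point c + z₀ itself need not lie in [0,1]. -/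
theorem NoGoodChoice.lt_abs_sub (H : NoGoodChoice h u v m) {t : ℕ} (ht : t < m) {c o z₀ : ℝ}
    (hc : c ∈ Fwd u v x t) (ho : o ∈ Bwd u v m x (t + 1)) (hz₀ : z₀ = v t ∨ z₀ = -u t) :
    h < |c + z₀ - o| := by
  obtain ⟨z, hz, hz', rfl⟩ := hc
  obtain ⟨z', hy, hy', rfl⟩ := ho
  set Z : ℕ → ℝ := fun i => if i < t then z i else if i = t then z₀ else z' i with hZ
  have hZc : IsChoice u v Z := fun i => by
    by_cases h1 : i < t
    · simpa [hZ, h1] using hz i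
    · by_cases h2 : i = t
      · subst h2
        simpa [hZ] using hz₀
      · simpa [hZ, h1, h2] using hy i
  have hpre : ∀ k ≤ t, ∑ i ∈ Finset.range k, Z i = ∑ i ∈ Finset.range k, z i := fun k hk =>
    Finset.sum_congr rfl fun i hi => if_pos (by have := Finset.mem_range.1 hi; omega)
  have hsuf : ∀ k, t + 1 ≤ k → ∑ i ∈ Finset.Ico k m, Z i = ∑ i ∈ Finset.Ico k m, z' i := fun k hk =>
    Finset.sum_congr rfl fun i hi => by
      have := Finset.mem_Ico.1 hi
      simp only [hZ]
      rw [if_neg (by omega), if_neg (by omega)]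
  have hmid : ∑ i ∈ Finset.range (t + 1), Z i = ∑ i ∈ Finset.range t, z i + z₀ := by
    rw [Finset.sum_range_succ, hpre t le_rfl]
    simp [hZ]
  have hsplit : ∀ k ≤ m, ∑ i ∈ Finset.range k, Z i + ∑ i ∈ Finset.Ico k m, Z i
    = ∑ i ∈ Finset.range m, Z i := fun k hk => Finset.sum_range_add_sum_Ico _ hk
  have hm := hsplit (t + 1) ht
  rw [hmid, hsuf _ le_rfl] at hm
  obtain ⟨k, hk, hlt⟩ := H Z hZc
  rcases le_or_gt k t with hkt | hkt
  · obtain ⟨h0, h1⟩ := hz' k hkt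
    rw [hpre k hkt, ← hm] at hlt
    rw [lt_abs] at hlt ⊢
    rcases hlt with hlt | hlt
    · right; linarith
    · left; linarith
  · obtain ⟨h0, h1⟩ := hy' k hkt hk
    have e := hsplit k hk
    rw [hsuf k hkt] at e
    rw [lt_abs] at hlt ⊢
    rcases hlt with hlt | hlt
    · left; linarith
    · right; linarith

/-- Positions must be reachable from all of `X`, while a label may belong to any point of `X`: each
pair then shares a starting point, as splicing requires. It is used for one point, and for {0, 1}
from time 1 on. -/
theorem NoGoodChoice.labelSystem (H : NoGoodChoice h u v m) (hu : ∀ i, 0 ≤ u i)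
    (hv : ∀ i, 0 ≤ v i) {X : Set ℝ} (hX : X.Nonempty) (j : ℕ)
    (hj : j ≤ m) :
    LabelSystem h (fun k => u (k + j)) (fun k => v (k + j)) (m - j)
      (fun k => {a | ∀ x ∈ X, a ∈ Fwd u v x (k + j)})
      (fun k => {o | ∃ x ∈ X, o ∈ Bwd u v m x (k + j)}) where
  R_subset k _ a ha := Fwd.subset _ (ha _ hX.some_mem)
  B_subset := by
    rintro k hk o ⟨x, -, ho⟩
    exact Bwd.subset (by omega) ho
  up_mem k hk a ha h1 x hx := by
    rw [add_right_comm]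
    exact Fwd.add_mem (ha x hx) (.inl rfl) ⟨add_nonneg (Fwd.subset _ (ha x hx)).1 (hv _), h1⟩
  down_mem k hk a ha h0 x hx := by
    rw [add_right_comm, sub_eq_add_neg]
    refine Fwd.add_mem (ha x hx) (.inr rfl) ⟨by linarith, ?_⟩
    have := (Fwd.subset _ (ha x hx)).2
    linarith [hu (k + j)]
  exists_label k hk o ho := by
    obtain ⟨x, hx, ho⟩ := ho
    rw [add_right_comm]
    exact (Bwd.add_mem (by omega) ho).imp (fun h => ⟨x, hx, h⟩) fun h => ⟨x, hx, h⟩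
  up_sep k hk a ha o ho := by
    obtain ⟨x, hx, ho⟩ := ho
    rw [add_right_comm] at ho
    exact H.lt_abs_sub (by omega) (ha x hx) ho (.inl rfl)
  down_sep k hk a ha o ho := by
    obtain ⟨x, hx, ho⟩ := ho
    rw [add_right_comm] at ho
    rw [sub_eq_add_neg a]
    exact H.lt_abs_sub (by omega) (ha x hx) ho (.inr rfl)

theorem Move.add_counter {h u v o : ℝ} {s t : ℝ × ℤ} (hst : Move h u v o s t) (c : ℤ) :
    Move h u v o (s.1, s.2 + c) (t.1, t.2 + c) := by
  rcases hst with ⟨h1, h2, h3, h4⟩ | ⟨h1, h2, h3, h4⟩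
  · exact .inl ⟨h1, h2, h3, by simp [h4]⟩
  · exact .inr ⟨h1, h2, h3, by simp [h4, add_right_comm]⟩

theorem Reach.mono {h : ℝ} {u v : ℕ → ℝ} {B B' : ℕ → Set ℝ} (hB : ∀ k, B k ⊆ B' k) {s₀ : ℝ × ℤ}
    {k : ℕ} {s : ℝ × ℤ} (hs : s ∈ Reach h u v B s₀ k) : s ∈ Reach h u v B' s₀ k := by
  induction k generalizing s with
  | zero => exact hs
  | succ k ih =>
    obtain ⟨r, hr, o, ho, hm⟩ := hs
    exact ⟨r, ih hr, o, hB _ ho, hm⟩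

theorem Reach.of_shift {h : ℝ} {u v : ℕ → ℝ} {B : ℕ → Set ℝ} {s₀ : ℝ × ℤ} {b : ℝ} {c : ℤ}
    (h1 : (b, c) ∈ Reach h u v B s₀ 1) {k : ℕ} {s : ℝ × ℤ}
    (hs : s ∈ Reach h (fun i => u (i + 1)) (fun i => v (i + 1)) (fun i => B (i + 1)) (b, 0) k) :
    (s.1, s.2 + c) ∈ Reach h u v B s₀ (k + 1) := by
  induction k generalizing s with
  | zero =>
    obtain rfl : s = (b, 0) := hs
    simpa using h1
  | succ k ih =>
    obtain ⟨r, hr, o, ho, hm⟩ := hs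
    exact ⟨_, ih hr, o, ho, hm.add_counter c⟩

theorem Reach.nonempty {h : ℝ} {u v : ℕ → ℝ} {B : ℕ → Set ℝ} {n : ℕ} (hu : ∀ k, 0 ≤ u k)
    (hv : ∀ k, 0 ≤ v k) (huv : ∀ k, u k + v k ≤ 1)
    (hB : ∀ k ≤ n, (B k ∩ Set.Icc 0 1).Nonempty) (s₀ : ℝ × ℤ) {k : ℕ} (hk : k ≤ n) :
    (Reach h u v B s₀ k).Nonempty := by
  induction k with
  | zero => exact ⟨s₀, rfl⟩
  | succ k ih =>
    obtain ⟨s, hs⟩ := ih (by omega)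
    obtain ⟨o, ho, ho'⟩ := hB _ hk
    obtain ⟨t, ht⟩ := exists_move h (hu k) (hv k) (huv k) ho' s
    exact ⟨t, s, hs, o, ho, ht⟩

/-! ### Trajectories and the dependence of the invariant on the starting point -/

/-- The sequence of signed items which uses exactly the items in `E` upwards. -/
def signed (u v : ℕ → ℝ) (E : Finset ℕ) (i : ℕ) : ℝ := if i ∈ E then v i else -u i

/-- The position at time `k` of the walk from `x` moving upwards at the times in `E`. -/
def position (u v : ℕ → ℝ) (x : ℝ) (E : Finset ℕ) (k : ℕ) : ℝ :=
  x + ∑ i ∈ Finset.range k, signed u v E i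

/-- The position at time `k` of the walk to `1 - x` moving upwards at the times in `T`. -/
def label (u v : ℕ → ℝ) (m : ℕ) (x : ℝ) (T : Finset ℕ) (k : ℕ) : ℝ :=
  1 - x - ∑ i ∈ Finset.Ico k m, signed u v T i

/-- The number of downward moves along items with `2 * h < u + v` before time `k`. -/
noncomputable def counter (h : ℝ) (u v : ℕ → ℝ) (E : Finset ℕ) (k : ℕ) : ℤ :=
  ∑ i ∈ Finset.range k, if i ∈ E then 0 else if 2 * h < u i + v i then 1 else 0

/-- The walk from `x` given by `E` stays inside the unit interval and its moves comply with the
labels given by `T`. -/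
def IsTrajectory (u v : ℕ → ℝ) (m : ℕ) (x : ℝ) (E T : Finset ℕ) : Prop :=
  (∀ k ≤ m, label u v m x T k ∈ Set.Icc (0 : ℝ) 1) ∧
    (∀ k ≤ m, position u v x E k ∈ Set.Icc (0 : ℝ) 1) ∧
    ∀ k < m, (k ∈ E → position u v x E k - u k ≤ label u v m x T (k + 1)) ∧
      (k ∉ E → label u v m x T (k + 1) ≤ position u v x E k + v k)

theorem isChoice_signed (E : Finset ℕ) : IsChoice u v (signed u v E) := fun i => by
  unfold signed
  split_ifs <;> simp

theorem label_mem_bwd {T : Finset ℕ} (hT : ∀ k ≤ m, label u v m x T k ∈ Set.Icc (0 : ℝ) 1) {k : ℕ} :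
    label u v m x T k ∈ Bwd u v m x k :=
  ⟨_, isChoice_signed T, fun k _ hk => hT k hk, rfl⟩

theorem IsTrajectory.mem_reach {E T : Finset ℕ} (H : IsTrajectory u v m x E T) {k : ℕ} (hk : k ≤ m) :
    (position u v x E k, counter h u v E k) ∈ Reach h u v (Bwd u v m x) (x, 0) k := by
  induction k with
  | zero => simp [Reach, position, counter]
  | succ k ih =>
    refine ⟨_, ih (by omega), _, label_mem_bwd H.1, ?_⟩
    have h1 := H.2.1 _ hk
    have h2 := H.2.2 k hk
    simp only [position, counter, signed, Finset.sum_range_succ, Move] at *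
    by_cases hE : k ∈ E
    · simp only [hE, if_true] at *
      exact .inl ⟨by ring, h1.2, h2.1 trivial, by simp⟩
    · simp only [hE, if_false] at *
      exact .inr ⟨by ring, h1.1, h2.2 not_false, trivial⟩

/-- Backwards greedily: from o, undo an upward move if o - v ≥ 0; otherwise o < v and o + u < u + v
≤ 1. -/
theorem exists_labels (hu : ∀ k, 0 ≤ u k) (hv : ∀ k, 0 ≤ v k) (huv : ∀ k, u k + v k ≤ 1)
    (hx : x ∈ Set.Icc (0 : ℝ) 1) :
    ∃ T ⊆ Finset.range m, ∀ k ≤ m, label u v m x T k ∈ Set.Icc (0 : ℝ) 1 := by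
  suffices H : ∀ j ≤ m, ∃ T ⊆ Finset.Ico j m, ∀ k, j ≤ k → k ≤ m →
      label u v m x T k ∈ Set.Icc (0 : ℝ) 1 by
    obtain ⟨T, hT, hT'⟩ := H 0 (by omega)
    exact ⟨T, by rwa [Finset.range_eq_Ico], fun k hk => hT' k (by omega) hk⟩
  intro j hj
  induction hj using Nat.decreasingInduction with
  | self =>
    refine ⟨∅, by simp, fun k hk hk' => ?_⟩
    obtain rfl : k = m := by omega
    simp only [label, Finset.Ico_self, Finset.sum_empty, Set.mem_Icc]
    constructor <;> linarith [hx.1, hx.2]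
  | of_succ j hj ih =>
    obtain ⟨T, hT, hT'⟩ := ih
    have hjT : j ∉ T := fun hh => by
      have := Finset.mem_Ico.1 (hT hh)
      omega
    have hT2 : T ⊆ Finset.Ico j m := hT.trans (Finset.Ico_subset_Ico_left (by omega))
    have e : ∀ k, j + 1 ≤ k → label u v m x (insert j T) k = label u v m x T k := fun k hk => by
      unfold label
      congr 1
      refine Finset.sum_congr rfl fun i hi => ?_
      have hij : i ≠ j := by have := Finset.mem_Ico.1 hi; omega
      simp [signed, hij]
    obtain ⟨h0, h1⟩ := hT' (j + 1) le_rfl hj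
    by_cases hc : 0 ≤ label u v m x T (j + 1) - v j
    · refine ⟨insert j T, Finset.insert_subset (by simpa using hj) hT2, fun k hk hk' => ?_⟩
      rcases hk.lt_or_eq with hk | rfl
      · rw [e k hk]
        exact hT' k hk hk'
      · have e2 : label u v m x (insert j T) j = label u v m x T (j + 1) - v j := by
          rw [← e _ le_rfl]
          simp only [label]
          rw [Finset.sum_eq_sum_Ico_succ_bot hj]
          simp [signed]
          ring
        rw [e2]
        exact ⟨hc, by linarith [hv j]⟩
    · refine ⟨T, hT2, fun k hk hk' => ?_⟩
      rcases hk.lt_or_eq with hk | rfl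
      · exact hT' k hk hk'
      · have e2 : label u v m x T j = label u v m x T (j + 1) + u j := by
          simp only [label]
          rw [Finset.sum_eq_sum_Ico_succ_bot hj]
          simp [signed, hjT]
          ring
        rw [e2]
        exact ⟨by linarith [hu j], by linarith [huv j]⟩

theorem exists_isTrajectory (hu : ∀ k, 0 ≤ u k) (hv : ∀ k, 0 ≤ v k) (huv : ∀ k, u k + v k ≤ 1)
    (hx : x ∈ Set.Icc (0 : ℝ) 1) :
    ∃ E ⊆ Finset.range m, ∃ T ⊆ Finset.range m, IsTrajectory u v m x E T := by
  obtain ⟨T, hT, hT'⟩ := exists_labels (m := m) hu hv huv hx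
  suffices H : ∀ j ≤ m, ∃ E ⊆ Finset.range j,
      (∀ k ≤ j, position u v x E k ∈ Set.Icc (0 : ℝ) 1) ∧
      ∀ k < j, (k ∈ E → position u v x E k - u k ≤ label u v m x T (k + 1)) ∧
        (k ∉ E → label u v m x T (k + 1) ≤ position u v x E k + v k) by
    obtain ⟨E, hE, hE'⟩ := H m le_rfl
    exact ⟨E, hE, T, hT, hT', hE'⟩
  intro j hj
  induction j with
  | zero => exact ⟨∅, by simp, fun k hk => by simpa [position, Nat.le_zero.1 hk] using hx, by simp⟩
  | succ j ih =>
    obtain ⟨E, hE, h1, h2⟩ := ih (by omega)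
    have hjE : j ∉ E := fun hh => by simpa using hE hh
    have hE2 : E ⊆ Finset.range (j + 1) := hE.trans (Finset.range_subset_range.2 (by omega))
    have e : ∀ k ≤ j, position u v x (insert j E) k = position u v x E k := fun k hk => by
      unfold position
      congr 1
      refine Finset.sum_congr rfl fun i hi => ?_
      have hij : i ≠ j := by have := Finset.mem_range.1 hi; omega
      simp [signed, hij]
    have hp := h1 j le_rfl
    have hl := hT' (j + 1) hj
    -- The threshold 0 affects only the counter, which is discarded.
    obtain ⟨⟨a', N'⟩, hm⟩ := exists_move 0 (hu j) (hv j) (huv j) hl (position u v x E j, 0)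
    rcases hm with ⟨m1, m2, m3, -⟩ | ⟨m1, m2, m3, -⟩ <;> simp only at m1 m2 m3
    · refine ⟨insert j E, Finset.insert_subset (by simp) hE2, fun k hk => ?_, fun k hk => ?_⟩
      · rcases hk.lt_or_eq with hk | rfl
        · rw [e k (by omega)]
          exact h1 k (by omega)
        · have e2 : position u v x (insert j E) (j + 1) = position u v x E j + v j := by
            rw [← e _ le_rfl]
            simp [position, Finset.sum_range_succ, signed, add_assoc]
          rw [e2]
          exact ⟨add_nonneg hp.1 (hv j), m1 ▸ m2⟩
      · rw [e k (by omega)]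
        rcases (Nat.lt_succ_iff.1 hk).lt_or_eq with hk | rfl
        · have hkj : k ≠ j := by omega
          simpa [hkj] using h2 k hk
        · simpa using m3
    · refine ⟨E, hE2, fun k hk => ?_, fun k hk => ?_⟩
      · rcases hk.lt_or_eq with hk | rfl
        · exact h1 k (by omega)
        · have e2 : position u v x E (j + 1) = position u v x E j - u j := by
            simp [position, Finset.sum_range_succ, signed, add_assoc, hjE, sub_eq_add_neg]
          rw [e2]
          exact ⟨m1 ▸ m2, by linarith [hp.2, hu j]⟩
      · rcases (Nat.lt_succ_iff.1 hk).lt_or_eq with hk | rfl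
        · exact h2 k hk
        · simpa [hjE] using m3

/-- The points for which some trajectory has an invariant satisfying `P`; the two alternatives
correspond to an arrival above and below the final label. -/
def invariantSet (h : ℝ) (u v : ℕ → ℝ) (m : ℕ) (P : ℤ → Prop) : Set ℝ :=
  ⋃ E ∈ (Finset.range m).powerset, ⋃ T ∈ (Finset.range m).powerset,
    {x | IsTrajectory u v m x E T ∧
      ((P (counter h u v E m) ∧ 1 - x ≤ position u v x E m) ∨
        (P (counter h u v E m - 1) ∧ position u v x E m ≤ 1 - x))}

/-- Finitely many `E` and `T`, and for each pair only weak inequalities between affine functions of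
x. The ambiguous case, arrival exactly at 1 - x, is excluded by `NoGoodChoice.lt_abs_sub_end`. -/
theorem isClosed_invariantSet (P : ℤ → Prop) : IsClosed (invariantSet h u v m P) := by
  refine isClosed_biUnion_finset fun E _ => isClosed_biUnion_finset fun T _ => ?_
  have hp : ∀ k, Continuous fun x => position u v x E k := fun k => by unfold position; fun_prop
  have hl : ∀ k, Continuous fun x => label u v m x T k := fun k => by unfold label; fun_prop
  have hall : ∀ {ι : Type} (p : ι → Prop) (q : ι → ℝ → Prop), (∀ i, IsClosed {x | q i x}) →
      IsClosed {x | ∀ i, p i → q i x} := fun p q hq => by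
    simp only [Set.ofPred_forall]
    exact isClosed_iInter fun i => isClosed_iInter fun _ => hq i
  refine IsClosed.inter (.inter ?_ (.inter ?_ ?_)) (.union ?_ ?_)
  · exact hall (fun k => k ≤ m) _ fun k => isClosed_Icc.preimage (hl k)
  · exact hall (fun k => k ≤ m) _ fun k => isClosed_Icc.preimage (hp k)
  · refine hall (fun k => k < m) _ fun k => ?_
    by_cases hE : k ∈ E
    · simpa [hE] using isClosed_le ((hp k).sub continuous_const) (hl _)
    · simpa [hE] using isClosed_le (hl _) ((hp k).add continuous_const)
  · exact .inter isClosed_const (isClosed_le (by fun_prop) (hp m))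
  · exact .inter isClosed_const (isClosed_le (hp m) (by fun_prop))

/-- The invariant of the state `s` relative to the label `o`. -/
noncomputable def invariant (o : ℝ) (s : ℝ × ℤ) : ℤ := s.2 - if s.1 < o then 1 else 0

theorem Bwd.eq_end {o : ℝ} (ho : o ∈ Bwd u v m x m) : o = 1 - x := by
  obtain ⟨z, -, -, rfl⟩ := ho
  simp

theorem Fwd.mem_start (hx : x ∈ Set.Icc (0 : ℝ) 1) : x ∈ Fwd u v x 0 :=
  ⟨_, fun _ => .inl rfl, fun k hk => by simpa [Nat.le_zero.1 hk] using hx, by simp⟩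

theorem NoGoodChoice.invariant_eq (H : NoGoodChoice h u v m) (hh : 1 / 4 ≤ h) (hu : ∀ k, 0 ≤ u k)
    (hv : ∀ k, 0 ≤ v k) (huv : ∀ k, u k + v k ≤ 1) (hx : x ∈ Set.Icc (0 : ℝ) 1) {s t : ℝ × ℤ}
    (hs : s ∈ Reach h u v (Bwd u v m x) (x, 0) m) (ht : t ∈ Reach h u v (Bwd u v m x) (x, 0) m) :
    invariant (1 - x) s = invariant (1 - x) t := by
  have S := H.labelSystem hu hv (Set.singleton_nonempty x) 0 (Nat.zero_le _)
  simp only [add_zero, Set.mem_singleton_iff, forall_eq, exists_eq_left, Nat.sub_zero] at S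
  have hl := S.reflTransGen_link hh hu hv huv (s₀ := (x, 0)) (Fwd.mem_start hx) le_rfl hs ht
  clear hs ht
  induction hl with
  | refl => rfl
  | tail _ hl ih =>
    obtain ⟨-, -, o, ho, hag⟩ := hl
    obtain rfl := Bwd.eq_end ho
    exact ih.trans hag.1

theorem NoGoodChoice.mem_invariantSet (H : NoGoodChoice h u v m) (hh : 1 / 4 ≤ h)
    (hu : ∀ k, 0 ≤ u k) (hv : ∀ k, 0 ≤ v k) (huv : ∀ k, u k + v k ≤ 1)
    (hx : x ∈ Set.Icc (0 : ℝ) 1) {s : ℝ × ℤ} (hs : s ∈ Reach h u v (Bwd u v m x) (x, 0) m)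
    (P : ℤ → Prop) : x ∈ invariantSet h u v m P ↔ P (invariant (1 - x) s) := by
  simp only [invariantSet, Set.mem_iUnion, Finset.mem_powerset]
  constructor
  · rintro ⟨E, -, T, -, hE, hP⟩
    rw [H.invariant_eq hh hu hv huv hx hs (hE.mem_reach le_rfl)]
    have hne := H.lt_abs_sub_end (x := x) (c := position u v x E m)
      ⟨_, isChoice_signed E, hE.2.1, rfl⟩
    have hne' : position u v x E m ≠ 1 - x := fun h0 => by
      rw [h0, sub_self, abs_zero] at hne
      linarith
    rcases hP with ⟨hP, hle⟩ | ⟨hP, hle⟩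
    · simpa [invariant, hle.not_gt] using hP
    · simpa [invariant, hle.lt_of_ne hne'] using hP
  · intro hP
    obtain ⟨E, hE, T, hT, hET⟩ := exists_isTrajectory (m := m) hu hv huv hx
    refine ⟨E, hE, T, hT, hET, ?_⟩
    rw [H.invariant_eq hh hu hv huv hx hs (hET.mem_reach le_rfl), invariant] at hP
    rcases lt_or_ge (position u v x E m) (1 - x) with hlt | hle
    · exact .inr ⟨by simpa [hlt] using hP, hlt.le⟩
    · exact .inl ⟨by simpa [hle.not_gt] using hP, hle⟩

/-- The invariant at time `m` is the same for all starting points of the unit interval. -/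
theorem NoGoodChoice.invariant_zero_eq_one (H : NoGoodChoice h u v m) (hh : 1 / 4 ≤ h)
    (hu : ∀ k, 0 ≤ u k) (hv : ∀ k, 0 ≤ v k) (huv : ∀ k, u k + v k ≤ 1) {s t : ℝ × ℤ}
    (hs : s ∈ Reach h u v (Bwd u v m 0) (0, 0) m) (ht : t ∈ Reach h u v (Bwd u v m 1) (1, 0) m) :
    invariant 1 s = invariant 0 t := by
  by_contra hne
  have h0 := fun P => H.mem_invariantSet hh hu hv huv (x := 0) (by simp) hs P
  have h1 := fun P => H.mem_invariantSet hh hu hv huv (x := 1) (by simp) ht P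
  rw [sub_zero] at h0
  rw [sub_self] at h1
  have hex : ∀ x ∈ Set.Icc (0 : ℝ) 1, ∃ i, ∀ P, x ∈ invariantSet h u v m P ↔ P i := fun x hx => by
    obtain ⟨E, -, T, -, hET⟩ := exists_isTrajectory (m := m) hu hv huv hx
    exact ⟨_, H.mem_invariantSet hh hu hv huv hx (hET.mem_reach le_rfl)⟩
  -- Two closed sets covering [0,1], each meeting it, must share a point, where the invariant would
  -- have two values.
  obtain ⟨x, hx, hx1, hx2⟩ := isPreconnected_closed_iff.1 (isPreconnected_Icc (a := (0 : ℝ)) (b := 1))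
    _ _ (isClosed_invariantSet (h := h) (u := u) (v := v) (m := m) fun i => i = invariant 1 s)
    (isClosed_invariantSet (h := h) (u := u) (v := v) (m := m) fun i => i ≠ invariant 1 s)
    (fun x hx => by
      obtain ⟨i, hi⟩ := hex x hx
      by_cases h2 : i = invariant 1 s
      · exact .inl ((hi _).2 h2)
      · exact .inr ((hi _).2 h2))
    ⟨0, by simp, (h0 _).2 rfl⟩ ⟨1, by simp, (h1 _).2 (Ne.symm hne)⟩
  obtain ⟨i, hi⟩ := hex x hx
  exact (hi _).1 hx2 ((hi _).1 hx1)

theorem not_noGoodChoice (hh : 1 / 4 ≤ h) (hh' : h < 1 / 2) (hm : 1 ≤ m) (hu : ∀ k, 0 ≤ u k)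
    (hv : ∀ k, 0 ≤ v k) (huv : ∀ k, u k + v k ≤ 1) (h0 : u 0 + v 0 = 1) : ¬ NoGoodChoice h u v m := by
  intro H
  have hlab : ∀ x ∈ Set.Icc (0 : ℝ) 1, ∀ k ≤ m, (Bwd u v m x k ∩ Set.Icc 0 1).Nonempty := by
    intro x hx k hk
    obtain ⟨T, -, hT⟩ := exists_labels (m := m) hu hv huv hx
    exact ⟨_, label_mem_bwd hT, hT k hk⟩
  have hreach : ∀ x ∈ Set.Icc (0 : ℝ) 1, (Reach h (fun i => u (i + 1)) (fun i => v (i + 1))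
      (fun i => Bwd u v m x (i + 1)) (v 0, 0) (m - 1)).Nonempty := fun x hx =>
    Reach.nonempty (fun _ => hu _) (fun _ => hv _) (fun _ => huv _)
      (fun k (hk : k ≤ m - 1) => hlab x hx _ (by omega)) _ le_rfl
  obtain ⟨s, hs⟩ := hreach 0 (by simp)
  obtain ⟨t, ht⟩ := hreach 1 (by simp)
  have hu0 := hu 0
  have hv0 := hv 0
  have first0 : (v 0, 0) ∈ Reach h u v (Bwd u v m 0) (0, 0) 1 := by
    obtain ⟨o, ho, ho'⟩ := hlab 0 (by simp) 1 hm
    exact ⟨_, rfl, o, ho, .inl ⟨by simp, by simp; linarith, by simp; linarith [ho'.1], rfl⟩⟩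
  have first1 : (v 0, 1) ∈ Reach h u v (Bwd u v m 1) (1, 0) 1 := by
    obtain ⟨o, ho, ho'⟩ := hlab 1 (by simp) 1 hm
    exact ⟨_, rfl, o, ho, .inr ⟨by simp; linarith, hv0, by simp; linarith [ho'.2],
      -- The first item is big because 2h < 1.
      by rw [if_pos (by linarith)]; rfl⟩⟩
  have hs' := Reach.of_shift first0 hs
  have ht' := Reach.of_shift first1 ht
  rw [Nat.sub_add_cancel hm] at hs' ht'
  have hfin := H.invariant_zero_eq_one hh hu hv huv hs' ht'
  have S := H.labelSystem hu hv (X := {0, 1}) ⟨0, by simp⟩ 1 hm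
  have hst : v 0 ∈ {a | ∀ x ∈ ({0, 1} : Set ℝ), a ∈ Fwd u v x (0 + 1)} := by
    rintro x (rfl | rfl)
    · simpa using Fwd.add_mem (u := u) (v := v) (Fwd.mem_start (x := 0) (by simp)) (.inl rfl)
        ⟨by simpa using hv0, by linarith⟩
    · have e : (1 : ℝ) + -u 0 = v 0 := by linarith
      simpa [e] using Fwd.add_mem (u := u) (v := v) (Fwd.mem_start (x := 1) (by simp)) (.inr rfl)
        (by rw [e]; exact ⟨hv0, by linarith⟩)
  have hsB := Reach.mono (B' := fun k => {o | ∃ x ∈ ({0, 1} : Set ℝ), o ∈ Bwd u v m x (k + 1)})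
    (fun k o ho => ⟨0, by simp, ho⟩) hs
  have htB := Reach.mono (B' := fun k => {o | ∃ x ∈ ({0, 1} : Set ℝ), o ∈ Bwd u v m x (k + 1)})
    (fun k o ho => ⟨1, by simp, ho⟩) ht
  have hl := S.reflTransGen_link hh (fun _ => hu _) (fun _ => hv _) (fun _ => huv _)
    (s₀ := (v 0, 0)) hst le_rfl hsB htB
  -- Common final positions lie below the label 1 and not below the label 0, so agreement relative
  -- to either label means equal counters.
  have hlt : ∀ a : ℝ, (∀ x ∈ ({0, 1} : Set ℝ), a ∈ Fwd u v x (m - 1 + 1)) → 0 ≤ a ∧ a < 1 := by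
    intro a ha
    have ha0 := ha 0 (by simp)
    rw [Nat.sub_add_cancel hm] at ha0
    obtain ⟨a0, a1⟩ := Fwd.subset _ ha0
    refine ⟨a0, a1.lt_of_ne ?_⟩
    rintro rfl
    have := H.lt_abs_sub_end ha0
    simp at this
    linarith
  have hR := fun (s : ℝ × ℤ) (hs) => hlt s.1 (S.mem_of_mem_reach (s₀ := (v 0, 0)) hst le_rfl (s := s) hs)
  have s01 := hR s hsB
  have t01 := hR t htB
  have hN : s.2 = t.2 := by
    clear hR s01 t01 hs ht hsB htB hs' ht' hfin
    induction hl with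
    | refl => rfl
    | tail _ hl ih =>
      refine ih.trans ?_
      obtain ⟨hb, hc, o, ⟨x, hx, ho⟩, hag, -⟩ := hl
      rw [Nat.sub_add_cancel hm] at ho
      obtain rfl := Bwd.eq_end ho
      obtain ⟨b0, b1⟩ := hlt _ hb
      obtain ⟨c0, c1⟩ := hlt _ hc
      rcases hx with rfl | rfl
      · simpa [b1, c1] using hag
      · simpa [b0.not_gt, c0.not_gt] using hag
  -- The invariants are s.2 - 1 and t.2 + 1, while s.2 = t.2.
  simp [invariant, s01.2, t01.1.not_gt] at hfin
  omega

/-! ### The upper bound for arbitrary items -/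

theorem exists_balanced {h : ℝ} (hh : 1 / 4 ≤ h) (hh' : h < 1 / 2) {u v : ℕ → ℝ}
    (hu : ∀ k, 0 ≤ u k) (hv : ∀ k, 0 ≤ v k) {W : ℝ} (hW : 0 < W) (huv : ∀ k, u k + v k ≤ W)
    {p q : ℕ} (hq : 1 ≤ q) (hp : u p + v p = W) :
    ∃ z : ℕ → ℝ, (∀ i < p + q, z i = v i ∨ z i = -u i) ∧ ∀ k ≤ p + q,
      |2 * ∑ i ∈ Finset.range k, z i - ∑ i ∈ Finset.range (p + q), z i| ≤ W * (1 + h) := by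
  -- Rotate item p to the front and scale by W. Moving an item past the end while negating it
  -- preserves the alternating sums up to sign; negation swaps u and v.
  set u' : ℕ → ℝ := fun i => if i < q then u (p + i) / W else v (i - q) / W with hu'
  set v' : ℕ → ℝ := fun i => if i < q then v (p + i) / W else u (i - q) / W with hv'
  have hgood := not_noGoodChoice (u := u') (v := v') (m := p + q) hh hh' (by omega)
    (fun k => by simp only [hu']; split_ifs <;> exact div_nonneg (by simp [hu, hv]) hW.le)
    (fun k => by simp only [hv']; split_ifs <;> exact div_nonneg (by simp [hu, hv]) hW.le)
    (fun k => by
      simp only [hu', hv']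
      split_ifs <;> rw [← add_div, div_le_one hW]
      · exact huv _
      · rw [add_comm]; exact huv _)
    (by simp only [hu', hv', if_pos (Nat.lt_of_lt_of_le Nat.zero_lt_one hq)]
        rw [← add_div, add_zero, hp, div_self hW.ne'])
  simp only [NoGoodChoice, not_forall, not_exists, not_and, not_lt] at hgood
  obtain ⟨y, hy, hbound⟩ := hgood
  set z : ℕ → ℝ := fun i => if i < p then -(W * y (q + i)) else W * y (i - p) with hz
  have hpre : ∀ k ≤ p, ∑ i ∈ Finset.range k, z i
      = -(W * (∑ i ∈ Finset.range (q + k), y i - ∑ i ∈ Finset.range q, y i)) := fun k hk => by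
    rw [Finset.sum_range_add, add_sub_cancel_left, Finset.mul_sum, ← Finset.sum_neg_distrib]
    exact Finset.sum_congr rfl fun i hi => if_pos (by have := Finset.mem_range.1 hi; omega)
  have hsuf : ∀ j, ∑ i ∈ Finset.range (p + j), z i
      = ∑ i ∈ Finset.range p, z i + W * ∑ i ∈ Finset.range j, y i := fun j => by
    rw [Finset.sum_range_add, Finset.mul_sum]
    simp [hz]
  have hm : ∑ i ∈ Finset.range (p + q), z i
      = W * (2 * ∑ i ∈ Finset.range q, y i - ∑ i ∈ Finset.range (p + q), y i) := by
    rw [hsuf, hpre p le_rfl, add_comm q p]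
    ring
  refine ⟨z, fun i hi => ?_, fun k hk => ?_⟩
  · rcases lt_or_ge i p with hip | hip
    · have h1 := hy (q + i)
      simp only [hu', hv', if_neg (show ¬ q + i < q by omega), Nat.add_sub_cancel_left] at h1
      simp only [hz, if_pos hip]
      rcases h1 with h1 | h1 <;> rw [h1]
      · right; field_simp
      · left; field_simp
    · have h1 := hy (i - p)
      simp only [hu', hv', if_pos (show i - p < q by omega), Nat.add_sub_cancel' hip] at h1
      simp only [hz, if_neg hip.not_gt]
      rcases h1 with h1 | h1 <;> rw [h1]
      · left; field_simp
      · right; field_simp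
  · rcases le_or_gt k p with hkp | hkp
    · rw [hpre k hkp, hm, show ∀ a b c : ℝ, 2 * -(W * (a - b)) - W * (2 * b - c) = -(W * (2 * a - c))
        from fun _ _ _ => by ring, abs_neg, abs_mul, abs_of_pos hW]
      exact mul_le_mul_of_nonneg_left (hbound _ (by omega)) hW.le
    · obtain ⟨j, rfl⟩ := Nat.exists_eq_add_of_le hkp.le
      rw [hm, hsuf, hpre p le_rfl, add_comm q p, show ∀ a b c : ℝ,
        2 * (-(W * (c - b)) + W * a) - W * (2 * b - c) = W * (2 * a - c)
        from fun _ _ _ => by ring, abs_mul, abs_of_pos hW]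
      exact mul_le_mul_of_nonneg_left (hbound _ (by omega)) hW.le

theorem sum_le_sub_sum_lt {m : ℕ} (z : Fin m → ℝ) (k : Fin m) :
    (∑ i with i ≤ k, z i) - (∑ i with k < i, z i) = 2 * (∑ i with i ≤ k, z i) - ∑ i, z i := by
  rw [← Finset.sum_filter_add_sum_filter_not Finset.univ (fun i => i ≤ k) z]
  simp only [not_le]
  ring

theorem sum_fin_le {m : ℕ} (z : ℕ → ℝ) (k : Fin m) :
    ∑ i : Fin m with i ≤ k, z i = ∑ i ∈ Finset.range (k + 1), z i := by
  rw [Finset.sum_filter]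
  simp only [Fin.le_def]
  rw [Fin.sum_univ_eq_sum_range (fun i => if i ≤ (k : ℕ) then z i else 0) m, ← Finset.sum_filter]
  congr 1
  ext i
  have := k.2
  simp only [Finset.mem_filter, Finset.mem_range]
  omega

theorem alternatingBound {h : ℝ} (hh : 1 / 4 ≤ h) (hh' : h < 1 / 2) : AlternatingBound (1 + h) := by
  intro m hm u v hu hv huv
  have : Nonempty (Fin m) := ⟨⟨0, hm⟩⟩
  obtain ⟨p, hp⟩ := Finite.exists_max fun i => u i + v i
  rcases (add_nonneg (hu p) (hv p)).eq_or_lt with h0 | hpos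
  · have hv0 : ∀ i, v i = 0 := fun i => by linarith [hp i, hu i, hv i]
    exact ⟨v, fun _ => .inl rfl, fun k => by simp [hv0]; linarith⟩
  · set U : ℕ → ℝ := fun i => if hi : i < m then u ⟨i, hi⟩ else 0 with hU
    set V : ℕ → ℝ := fun i => if hi : i < m then v ⟨i, hi⟩ else 0 with hV
    obtain ⟨q, hq⟩ := Nat.exists_eq_add_of_lt p.2
    have hm' : m = p + (q + 1) := by omega
    obtain ⟨z, hz, hz'⟩ := exists_balanced hh hh' (u := U) (v := V) (p := p) (q := q + 1)
      (fun k => by simp only [hU]; split_ifs <;> simp [hu])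
      (fun k => by simp only [hV]; split_ifs <;> simp [hv]) hpos
      (fun k => by
        simp only [hU, hV]
        split_ifs
        · exact hp _
        · simpa using hpos.le) (by omega) (by simp [hU, hV])
    rw [← hm'] at hz hz'
    refine ⟨fun i => z i, fun k => by simpa [hU, hV] using hz k k.2, fun k => ?_⟩
    rw [sum_le_sub_sum_lt, sum_fin_le z, Fin.sum_univ_eq_sum_range z m]
    refine (hz' _ k.2).trans ?_
    have := huv p
    nlinarith

/-! ### The lower bound and the interval for the constant -/

theorem le_of_alternatingBound {α : ℝ} (hα : AlternatingBound α) : 11 / 10 ≤ α := by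
  -- Units of 1/10. All U i + V i are even and the V i have odd sum, so every alternating sum is
  -- odd: exceeding 9 already means at least 11.
  let U : Fin 9 → ℤ := ![5, 1, 4, 4, 2, 3, 7, 3, 2]
  let V : Fin 9 → ℤ := ![5, 9, 4, 6, 2, 7, 1, 7, 2]
  have hforced : ∀ b : Fin 9 → Bool, ∃ k : Fin 9,
      11 ≤ |(∑ i with i ≤ k, bif b i then V i else -U i) -
        ∑ i with k < i, bif b i then V i else -U i| := by
    decide +kernel
  have hU : ∀ i, 0 ≤ U i := by decide
  have hV : ∀ i, 0 ≤ V i := by decide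
  have hUV : ∀ i, U i + V i ≤ 10 := by decide
  obtain ⟨z, hz, hz'⟩ := hα 9 (by norm_num) (fun i => U i / 10) (fun i => V i / 10)
    (fun i => div_nonneg (by exact_mod_cast hU i) (by norm_num))
    (fun i => div_nonneg (by exact_mod_cast hV i) (by norm_num))
    (fun i => by
      rw [← add_div, div_le_one (by norm_num)]
      exact_mod_cast hUV i)
  classical
  obtain ⟨k, hk⟩ := hforced fun i => decide (z i = V i / 10)
  have hzi : ∀ i, z i
      = ((bif decide (z i = V i / 10) then V i else -U i : ℤ) : ℝ) / 10 := fun i => by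
    by_cases h1 : z i = V i / 10
    · simp [h1]
    · have := (hz i).resolve_left h1
      simp only [h1, decide_false, cond_false]
      rw [this]
      push_cast
      ring
  refine le_trans ?_ (hz' k)
  rw [Finset.sum_congr rfl fun i _ => hzi i, Finset.sum_congr (s₁ := {i | k < i}) rfl fun i _ => hzi i,
    ← Finset.sum_div, ← Finset.sum_div, ← sub_div, abs_div, abs_of_pos (show (0 : ℝ) < 10 by norm_num)]
  refine div_le_div_of_nonneg_right ?_ (by norm_num)
  exact_mod_cast hk

theorem alternatingBound_thirteen_tenths : AlternatingBound (13 / 10) := by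
  have := alternatingBound (h := 3 / 10) (by norm_num) (by norm_num)
  norm_num at this
  exact this

theorem sswBeta_mem_Icc : sswBeta ∈ Set.Icc (11 / 10 : ℝ) (13 / 10) :=
  ⟨le_csInf ⟨_, alternatingBound_thirteen_tenths⟩ fun _ => le_of_alternatingBound,
    csInf_le ⟨_, fun _ => le_of_alternatingBound⟩ alternatingBound_thirteen_tenths⟩

/-! ### From the ring to alternating sums -/

/-- The effect on the load of the edge `e` of routing a unit more of the demand `p` clockwise. -/
noncomputable def edgeSign {n : ℕ} (p : RingPair n) (e : Fin n) : ℝ :=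
  if e ∈ clockwisePath p then 1 else -1

theorem edgeLoad_add {n : ℕ} (d x w : RingPair n → ℝ) (e : Fin n) :
    edgeLoad d (x + w) e = edgeLoad d x e + ∑ p, w p * edgeSign p e := by
  simp only [edgeLoad, edgeSign, Finset.sum_filter, counterclockwisePath, Finset.mem_compl,
    ← Finset.sum_add_distrib]
  refine Finset.sum_congr rfl fun p _ => ?_
  by_cases h : e ∈ clockwisePath p <;> simp [h]
  ring

open Classical in
/-- The demands which are split by the routing `x`. -/
noncomputable def splitPairs {n : ℕ} (d x : RingPair n → ℝ) : Finset (RingPair n) :=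
  {p | 0 < x p ∧ x p < d p}

theorem mem_splitPairs {n : ℕ} {d x : RingPair n → ℝ} {p : RingPair n} :
    p ∈ splitPairs d x ↔ 0 < x p ∧ x p < d p := by
  simp [splitPairs]

theorem IsSplitRouting.eq_or_eq {n : ℕ} {d x : RingPair n → ℝ} (hx : IsSplitRouting d x)
    {p : RingPair n} (hp : p ∉ splitPairs d x) : x p = d p ∨ x p = 0 := by
  rw [mem_splitPairs, not_and, not_lt] at hp
  rcases (hx p).1.eq_or_lt with h | h
  · exact .inr h.symm
  · exact .inl ((hx p).2.antisymm (hp h))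

/-- The pairs `p` and `q` cross, with the first node of `p` before that of `q`. -/
def CrossesBefore {n : ℕ} (p q : RingPair n) : Prop :=
  p.1.1 < q.1.1 ∧ q.1.1 < p.1.2 ∧ p.1.2 < q.1.2

/-- Disjoint clockwise paths are both increased; for nested ones the inner is increased and the
outer decreased. -/
theorem exists_sign_of_not_crosses {n : ℕ} {p q : RingPair n} (hpq : ¬ CrossesBefore p q)
    (hqp : ¬ CrossesBefore q p) : ∃ s t : ℝ, (s = 1 ∨ s = -1) ∧ (t = 1 ∨ t = -1) ∧
      ∀ e, s * edgeSign p e + t * edgeSign q e ≤ 0 := by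
  obtain ⟨⟨i, j⟩, hij⟩ := p
  obtain ⟨⟨k, l⟩, hkl⟩ := q
  simp only [CrossesBefore, Fin.lt_def] at *
  have hcases : j ≤ k ∨ l ≤ i ∨ (i ≤ k ∧ l ≤ j) ∨ (k ≤ i ∧ j ≤ l) := by
    simp only [Fin.le_def]
    omega
  simp only [edgeSign, clockwisePath, Finset.mem_Ico, Fin.le_def, Fin.lt_def] at *
  rcases hcases with h | h | h | h
  · refine ⟨1, 1, .inl rfl, .inl rfl, fun e => ?_⟩
    split_ifs <;> first | (exfalso; omega) | norm_num
  · refine ⟨1, 1, .inl rfl, .inl rfl, fun e => ?_⟩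
    split_ifs <;> first | (exfalso; omega) | norm_num
  · refine ⟨-1, 1, .inr rfl, .inl rfl, fun e => ?_⟩
    split_ifs <;> first | (exfalso; omega) | norm_num
  · refine ⟨1, -1, .inl rfl, .inr rfl, fun e => ?_⟩
    split_ifs <;> first | (exfalso; omega) | norm_num

theorem exists_capacity {a b s : ℝ} (ha : 0 < a) (hab : a < b) (hs : s = 1 ∨ s = -1) :
    ∃ c > 0, (∀ ε, 0 ≤ ε → ε ≤ c → 0 ≤ a + ε * s ∧ a + ε * s ≤ b) ∧
      (a + c * s = b ∨ a + c * s = 0) := by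
  rcases hs with rfl | rfl
  · exact ⟨b - a, by linarith, fun ε h0 h1 => ⟨by linarith, by linarith⟩, .inl (by ring)⟩
  · exact ⟨a, ha, fun ε h0 h1 => ⟨by linarith, by linarith⟩, .inr (by ring)⟩

/-- Two split demands which do not cross can be rerouted so that one of them becomes unsplit. -/
theorem IsSplitRouting.exists_reroute {n : ℕ} {d x : RingPair n → ℝ} (hx : IsSplitRouting d x)
    {p q : RingPair n} (hp : p ∈ splitPairs d x) (hq : q ∈ splitPairs d x) (hne : p ≠ q)
    (hpq : ¬ CrossesBefore p q) (hqp : ¬ CrossesBefore q p) :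
    ∃ y, IsSplitRouting d y ∧ splitPairs d y ⊂ splitPairs d x ∧
      ∀ e, edgeLoad d y e ≤ edgeLoad d x e := by
  classical
  obtain ⟨s, t, hs, ht, hst⟩ := exists_sign_of_not_crosses hpq hqp
  rw [mem_splitPairs] at hp hq
  obtain ⟨c, hc, hc', hc''⟩ := exists_capacity hp.1 hp.2 hs
  obtain ⟨c₂, hc₂, hc₂', hc₂''⟩ := exists_capacity hq.1 hq.2 ht
  set ε := min c c₂ with hε
  have hε0 : 0 < ε := lt_min hc hc₂
  set y : RingPair n → ℝ := x + (Pi.single p (ε * s) + Pi.single q (ε * t)) with hy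
  have yp : y p = x p + ε * s := by simp [hy, hne]
  have yq : y q = x q + ε * t := by simp [hy, hne.symm]
  have yr : ∀ r, r ≠ p → r ≠ q → y r = x r := fun r h1 h2 => by simp [hy, h1, h2]
  refine ⟨y, fun r => ?_, ?_, fun e => ?_⟩
  · rcases eq_or_ne r p with rfl | h1
    · rw [yp]; exact hc' _ hε0.le (min_le_left _ _)
    rcases eq_or_ne r q with rfl | h2
    · rw [yq]; exact hc₂' _ hε0.le (min_le_right _ _)
    · rw [yr r h1 h2]; exact hx r
  · refine Finset.ssubset_iff_subset_ne.2 ⟨fun r hr => ?_, fun heq => ?_⟩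
    · rcases eq_or_ne r p with rfl | h1
      · exact mem_splitPairs.2 hp
      rcases eq_or_ne r q with rfl | h2
      · exact mem_splitPairs.2 hq
      · rwa [mem_splitPairs, yr r h1 h2, ← mem_splitPairs] at hr
    · rcases min_choice c c₂ with h | h
      · have := mem_splitPairs.1 (heq ▸ mem_splitPairs.2 hp : p ∈ splitPairs d y)
        rw [yp, hε, h] at this
        rcases hc'' with h1 | h1 <;> rw [h1] at this <;> exact absurd this (by simp)
      · have := mem_splitPairs.1 (heq ▸ mem_splitPairs.2 hq : q ∈ splitPairs d y)
        rw [yq, hε, h] at this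
        rcases hc₂'' with h1 | h1 <;> rw [h1] at this <;> exact absurd this (by simp)
  · rw [hy, edgeLoad_add]
    simp only [Pi.add_apply, add_mul, Finset.sum_add_distrib, Pi.single_apply, ite_mul, zero_mul,
      Finset.sum_ite_eq', Finset.mem_univ, if_true]
    have := mul_nonpos_of_nonneg_of_nonpos hε0.le (hst e)
    linarith

theorem abs_sum_lowerSet_le {m : ℕ} {z : Fin m → ℝ} {α : ℝ} (hm : 1 ≤ m)
    (hz : ∀ k, |(∑ i with i ≤ k, z i) - (∑ i with k < i, z i)| ≤ α) (P : Fin m → Prop)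
    [DecidablePred P] (hP : ∀ a b, a ≤ b → P b → P a) :
    |∑ i, z i * (if P i then 1 else -1)| ≤ α := by
  have hsplit : ∀ k, ∑ i, z i * (if i ≤ k then 1 else -1)
      = (∑ i with i ≤ k, z i) - (∑ i with k < i, z i) := fun k => by
    rw [Finset.sum_filter, Finset.sum_filter, ← Finset.sum_sub_distrib]
    refine Finset.sum_congr rfl fun i _ => ?_
    by_cases h : i ≤ k
    · simp [h, h.not_gt]
    · simp [h, not_le.1 h]
  by_cases hne : ∃ a, P a
  · obtain ⟨a, ha⟩ := hne
    obtain ⟨k, hk, hmax⟩ := ({i | P i} : Finset (Fin m)).exists_max_image id ⟨a, by simpa using ha⟩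
    have e : ∀ i, P i ↔ i ≤ k := fun i => ⟨fun hi => hmax i (by simpa using hi),
      fun hi => hP i k hi (by simpa using hk)⟩
    simp only [e, hsplit]
    exact hz k
  -- The empty segment is the negative of the full one, k = m - 1.
  · push Not at hne
    have hlast := hz ⟨m - 1, by omega⟩
    rw [← hsplit] at hlast
    have e : ∀ i : Fin m, i ≤ ⟨m - 1, by omega⟩ := fun i => Fin.le_def.2 (by simp; omega)
    simp only [e, if_true, mul_one] at hlast
    simpa [hne] using hlast

theorem exists_enumeration {n : ℕ} {T : Finset (RingPair n)}
    (hT : ∀ p ∈ T, ∀ q ∈ T, p ≠ q → CrossesBefore p q ∨ CrossesBefore q p) :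
    ∃ f : Fin T.card → RingPair n, Function.Injective f ∧ Set.range f = T ∧
      ∀ a b, a < b → CrossesBefore (f a) (f b) := by
  classical
  have hinj : Set.InjOn (fun p : RingPair n => p.1.1) T := fun p hp q hq h => by
    by_contra hne
    rcases hT p hp q hq hne with h1 | h1
    · exact h1.1.ne h
    · exact h1.1.ne' h
  have hcard := Finset.card_image_of_injOn hinj
  have hmem := fun a => Finset.mem_image.1 (Finset.orderEmbOfFin_mem _ hcard a)
  choose f hf hf' using hmem
  have hfi : Function.Injective f := fun a b hab => by
    refine (Finset.orderEmbOfFin _ hcard).injective ?_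
    rw [← hf', ← hf', hab]
  refine ⟨f, hfi, ?_, fun a b hab => ?_⟩
  · have h1 : Finset.univ.image f = T := Finset.eq_of_subset_of_card_le
      (fun p hp => by
        obtain ⟨a, -, rfl⟩ := Finset.mem_image.1 hp
        exact hf a) (by rw [Finset.card_image_of_injective _ hfi]; simp)
    exact (by simp : Set.range f = (Finset.univ.image f : Finset _)).trans (congrArg _ h1)
  · refine (hT _ (hf a) _ (hf b) (hfi.ne hab.ne)).resolve_right fun h => ?_
    have h1 := (Finset.orderEmbOfFin _ hcard).strictMono hab
    rw [← hf', ← hf'] at h1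
    exact h1.not_gt h.1

/-- Pairwise crossing puts all first nodes before all second nodes. So an edge cuts either the list
of first nodes or the list of second nodes, and the signs are + or - on an initial segment and
opposite on the rest. -/
theorem abs_sum_mul_edgeSign_le {n m : ℕ} {z : Fin m → ℝ} {α : ℝ} (hm : 1 ≤ m)
    (hz : ∀ k, |(∑ i with i ≤ k, z i) - (∑ i with k < i, z i)| ≤ α) {f : Fin m → RingPair n}
    (hf : ∀ a b, a < b → CrossesBefore (f a) (f b)) (e : Fin n) :
    |∑ a, z a * edgeSign (f a) e| ≤ α := by
  have hij : ∀ a b, (f a).1.1 < (f b).1.2 := fun a b => by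
    rcases lt_trichotomy a b with h | rfl | h
    · exact (hf a b h).1.trans (f b).2
    · exact (f a).2
    · exact (hf b a h).2.1
  simp only [edgeSign, clockwisePath, Finset.mem_Ico]
  by_cases he : ∃ b, (f b).1.2 ≤ e
  · obtain ⟨b, hb⟩ := he
    have h1 := abs_sum_lowerSet_le hm hz (fun a => (f a).1.2 ≤ e) fun a b hab hb => by
      rcases hab.lt_or_eq with h | rfl
      · exact (hf a b h).2.2.le.trans hb
      · exact hb
    rw [← abs_neg, ← Finset.sum_neg_distrib]
    convert h1 using 3 with a
    have h2 : (f a).1.1 ≤ e := (hij a b).le.trans hb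
    by_cases h3 : (f a).1.2 ≤ e
    · simp [h2, h3, h3.not_gt]
    · simp [h2, h3, not_le.1 h3]
  · push Not at he
    have h1 := abs_sum_lowerSet_le hm hz (fun a => (f a).1.1 ≤ e) fun a b hab hb => by
      rcases hab.lt_or_eq with h | rfl
      · exact (hf a b h).1.le.trans hb
      · exact hb
    simpa [he] using h1

theorem le_maxDemand {n : ℕ} (d : RingPair n → ℝ) (p : RingPair n) : d p ≤ maxDemand d :=
  le_ciSup (Set.finite_range d).bddAbove p

theorem AlternatingBound.exists_unsplittable_of_crossing {α : ℝ} (hα : AlternatingBound α) {n : ℕ}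
    {d x : RingPair n → ℝ} (hx : IsSplitRouting d x) (hne : (splitPairs d x).Nonempty)
    (hT : ∀ p ∈ splitPairs d x, ∀ q ∈ splitPairs d x, p ≠ q → CrossesBefore p q ∨ CrossesBefore q p) :
    ∃ y, IsUnsplittableRouting d y ∧ ∀ e, edgeLoad d y e ≤ edgeLoad d x e + α * maxDemand d := by
  obtain ⟨f, hfi, hfr, hf⟩ := exists_enumeration hT
  have hm : 1 ≤ (splitPairs d x).card := hne.card_pos
  have hfT : ∀ a, 0 < x (f a) ∧ x (f a) < d (f a) := fun a => by
    rw [← mem_splitPairs, ← Finset.mem_coe, ← hfr]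
    exact ⟨a, rfl⟩
  set D := maxDemand d
  have hD : 0 < D := (hfT ⟨0, hm⟩).1.trans ((hfT _).2.trans_le (le_maxDemand d _))
  obtain ⟨z, hz, hz'⟩ := hα _ hm (fun a => x (f a) / D) (fun a => (d (f a) - x (f a)) / D)
    (fun a => div_nonneg (hfT a).1.le hD.le) (fun a => div_nonneg (by linarith [(hfT a).2]) hD.le)
    (fun a => by
      rw [← add_div, div_le_one hD, add_sub_cancel]
      exact le_maxDemand d _)
  -- With u = x/D and v = (d - x)/D, the sum x + D z is d or 0; unsplit demands are unchanged.
  refine ⟨x + fun p => D * Function.extend f z 0 p, fun p => ?_, fun e => ?_⟩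
  · simp only [Pi.add_apply]
    by_cases hp : p ∈ splitPairs d x
    · rw [← Finset.mem_coe, ← hfr] at hp
      obtain ⟨a, rfl⟩ := hp
      rw [hfi.extend_apply]
      rcases hz a with h | h <;> rw [h]
      · left; field_simp; ring
      · right; field_simp; ring
    · rw [Function.extend_apply' _ _ _ (by
        rwa [← Finset.mem_coe, ← hfr] at hp)]
      simpa using hx.eq_or_eq hp
  · rw [edgeLoad_add]
    have h1 : ∑ p, D * Function.extend f z 0 p * edgeSign p e = D * ∑ a, z a * edgeSign (f a) e := by
      rw [Finset.mul_sum]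
      symm
      refine Finset.sum_of_injOn f hfi.injOn (fun _ _ => by simp) (fun p _ hp => ?_) fun a _ => ?_
      · rw [Function.extend_apply' _ _ _ (by simpa using hp)]
        simp
      · rw [hfi.extend_apply, mul_assoc]
    rw [h1, mul_comm α]
    gcongr
    exact (le_abs_self _).trans (abs_sum_mul_edgeSign_le hm hz' hf e)

theorem AlternatingBound.exists_unsplittable {α : ℝ} (hα : AlternatingBound α) (hα0 : 0 ≤ α) {n : ℕ}
    {d x : RingPair n → ℝ} (hD : 0 ≤ maxDemand d) (hx : IsSplitRouting d x) :
    ∃ y, IsUnsplittableRouting d y ∧ ∀ e, edgeLoad d y e ≤ edgeLoad d x e + α * maxDemand d := by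
  induction hT : splitPairs d x using Finset.strongInduction generalizing x with
  | H T ih =>
    subst hT
    rcases (splitPairs d x).eq_empty_or_nonempty with h0 | hne
    · exact ⟨x, fun p => hx.eq_or_eq (by simp [h0]), fun e => by
        have := mul_nonneg hα0 hD
        linarith⟩
    by_cases hcross : ∀ p ∈ splitPairs d x, ∀ q ∈ splitPairs d x, p ≠ q →
        CrossesBefore p q ∨ CrossesBefore q p
    · exact hα.exists_unsplittable_of_crossing hx hne hcross
    · push Not at hcross
      obtain ⟨p, hp, q, hq, hpq, h1, h2⟩ := hcross
      obtain ⟨y, hy, hss, hle⟩ := hx.exists_reroute hp hq hpq h1 h2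
      obtain ⟨w, hw, hle'⟩ := ih _ hss hy rfl
      exact ⟨w, hw, fun e => (hle' e).trans (by linarith [hle e])⟩

theorem unsplittableOpt_le {n : ℕ} (hn : 2 ≤ n) {d : RingPair n → ℝ} (hd : ∀ p, 0 ≤ d p) {c : ℝ}
    (H : ∀ x, IsSplitRouting d x → ∃ y, IsUnsplittableRouting d y ∧
      ∀ e, edgeLoad d y e ≤ edgeLoad d x e + c) : unsplittableOpt d ≤ splitOpt d + c := by
  have : Nonempty (Fin n) := ⟨⟨0, by omega⟩⟩
  obtain ⟨x, hx, hxl⟩ := (isLeast_splitOpt hn d hd).1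
  obtain ⟨y, hy, hle⟩ := H x hx
  refine ((isLeast_unsplittableOpt d).2 ⟨y, hy, rfl⟩).trans (ciSup_le fun e => (hle e).trans ?_)
  rw [← hxl]
  gcongr
  exact le_ciSup (f := edgeLoad d x) (Set.finite_range _).bddAbove e

end RingLoading

theorem theorem1 :
    (∀ (n : ℕ) (_hn : 2 ≤ n) (d : RingPair n → ℝ) (_hd : ∀ p, 0 ≤ d p),
      (∀ x, RingLoading.IsSplitRouting d x →
        ∃ y, RingLoading.IsUnsplittableRouting d y ∧
          ∀ e, RingLoading.edgeLoad d y e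
            ≤ RingLoading.edgeLoad d x e + 13 / 10 * RingLoading.maxDemand d) ∧
      RingLoading.unsplittableOpt d
        ≤ RingLoading.splitOpt d + 13 / 10 * RingLoading.maxDemand d) ∧
    RingLoading.sswBeta ∈ Set.Icc (11 / 10 : ℝ) (13 / 10) := by
  refine ⟨fun n hn d hd => ?_, RingLoading.sswBeta_mem_Icc⟩
  have hD : 0 ≤ RingLoading.maxDemand d := Real.iSup_nonneg hd
  have H := fun x (hx : RingLoading.IsSplitRouting d x) =>
    RingLoading.alternatingBound_thirteen_tenths.exists_unsplittable (by norm_num) hD hx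
  exact ⟨H, RingLoading.unsplittableOpt_le hn hd H⟩
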